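/- Let $\{S[t]\}_{t\ge 1}$ be a discrete memoryless source with finite alphabet $\mathcal S$, i.e. the $S[t]$ are i.i.d. copies of a random variable $S$ with entropy $H(S)$, and let $S^n=(S[1],\dots,S[n])$. Let $L,N,m$ be integers with $0\le N<m\le L$ and put $\Omega_L=\{1,\dots,L\}$. In the $(L,N,m)$ secure symmetrical single-level diversity coding problem, an $(n,(M_1,\dots,M_L))$ code consists of a key space $\mathcal K$ of arbitrary size, a random key $K$ in $\mathcal K$ (of arbitrary law) that is independent of $S^n$, encoding functions $e_l:\mathcal S^n\times\mathcal K\to\{1,\dots,M_l\}$ for $l=1,\dots,L$, and decoding functions $d_U:\prod_{l\in U}\{1,\dots,M_l\}\to\mathcal S^n$ for all $U\subseteq\Omega_L$ with $|U|\ge m$. Write $X_l=e_l(S^n,K)$ and $X_U=(X_l)_{l\in U}$. A tuple $(R_1,\dots,R_L)$ of nonnegative reals is admissible if for every $\epsilon>0$ and for all sufficiently large $n$ there is an $(n,(M_1,\dots,M_L))$ code such that (i) $\frac1n\log M_l\le R_l+\epsilon$ for all $l=1,\dots,L$; (ii) $\Pr\{d_U(X_U)\ne S^n\}\le\epsilon$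 for all $U\subseteq\Omega_L$ with $|U|\ge m$; (iii) $H(S^n\mid X_A)=H(S^n)$ for all $A\subseteq\Omega_L$ with $|A|\le N$. (Logarithms and entropies are taken to the same base.) Theorem. The set of all admissible rate tuples is exactly $$\mathcal R(L,m-N,H(S))=\Big\{(R_1,\dots,R_L): R_l\ge 0 \text{ for all } l,\ \sum_{l\in D}R_l\ge H(S)\text{ for all } D\subseteq\Omega_L \text{ with } |D|=m-N\Big\}.$$ -/

import Mathlib

open MeasureTheory Filter

noncomputable section

namespace SSDC

/-- The Shannon entropy `H(X)` (in nats) of a random variable `X` with values in a finite set,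
on a probability space `(Ω, μ)`. -/
def entropy {Ω α : Type*} [MeasurableSpace Ω] [Fintype α] (μ : Measure Ω) (X : Ω → α) : ℝ :=
  ∑ a : α, Real.negMulLog (μ.real {ω | X ω = a})

/-- The conditional entropy `H(X | Y) = ∑ y, P(Y = y) H(X | Y = y)` (in nats) of finitely valued
random variables. Values `y` of probability zero contribute nothing. -/
def condEntropy {Ω α β : Type*} [MeasurableSpace Ω] [Fintype α] [Fintype β]
    (μ : Measure Ω) (X : Ω → α) (Y : Ω → β) : ℝ :=
  ∑ y : β, μ.real {ω | Y ω = y} *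
    ∑ x : α, Real.negMulLog (μ.real {ω | X ω = x ∧ Y ω = y} / μ.real {ω | Y ω = y})

/-- The entropy `H(S)` of a memoryless source whose letters have the law `P`. -/
def sourceEntropy {S : Type*} [MeasurableSpace S] [Fintype S] (P : Measure S) : ℝ :=
  entropy P (fun s : S => s)

/-- An `(n, (M₁, …, M_L))` code with key space `K`, for source sequences in `Sⁿ`:
an encoding function `e_l : Sⁿ × K → {1, …, M_l}` for each of the `L` encoders, and a decoding
function `d_U : ∏_{l ∈ U} {1, …, M_l} → Sⁿ` for every set `U` of at least `m` encoders. -/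
structure Code (S K : Type*) [MeasurableSpace S] [MeasurableSpace K]
    (L m n : ℕ) (M : Fin L → ℕ) where
  enc : ∀ l : Fin L, (Fin n → S) × K → Fin (M l)
  measurable_enc : ∀ l : Fin L, Measurable (enc l)
  dec : ∀ U : Finset (Fin L), m ≤ U.card → (∀ l : U, Fin (M l)) → (Fin n → S)

/-- `X_U = (X_l)_{l ∈ U}`, where `X_l = e_l(Sⁿ, K)`, as a random variable on `Sⁿ × K`. -/
def Code.output {S K : Type*} [MeasurableSpace S] [MeasurableSpace K]
    {L m n : ℕ} {M : Fin L → ℕ} (c : Code S K L m n M) (U : Finset (Fin L))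
    (ω : (Fin n → S) × K) : ∀ l : U, Fin (M l) :=
  fun l => c.enc l ω

/-- The joint law of the first `n` letters `Sⁿ` of the memoryless source with letter law `P` and
of the secret key, which has the law `κ` and is independent of the source. -/
def jointLaw {S K : Type*} [MeasurableSpace S] [MeasurableSpace K]
    (P : Measure S) (κ : Measure K) (n : ℕ) : Measure ((Fin n → S) × K) :=
  (Measure.pi (fun _ : Fin n => P)).prod κ

/-- The code, used with a key of law `κ`, meets the rate constraints, reconstruction constraints
and perfect secrecy constraints of the `(L, N, m)` problem at the rate tuple `R` and the
tolerance `ε`. -/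
structure Code.Meets {S K : Type*} [Fintype S] [MeasurableSpace S] [MeasurableSpace K]
    {L m n : ℕ} {M : Fin L → ℕ} (c : Code S K L m n M)
    (P : Measure S) (κ : Measure K) (N : ℕ) (R : Fin L → ℝ) (ε : ℝ) : Prop where
  rate : ∀ l : Fin L, Real.log (M l : ℝ) / (n : ℝ) ≤ R l + ε
  reconstruction : ∀ (U : Finset (Fin L)) (hU : m ≤ U.card),
    (jointLaw P κ n).real {ω | c.dec U hU (c.output U ω) ≠ ω.1} ≤ ε
  secrecy : ∀ A : Finset (Fin L), A.card ≤ N →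
    condEntropy (jointLaw P κ n) (fun ω => ω.1) (c.output A) =
      entropy (jointLaw P κ n) (fun ω => ω.1)

/-- The rate tuple `R` is admissible for the `(L, N, m)` secure symmetrical single-level diversity
coding problem with a memoryless source of letter law `P`. The key space and the law of the key
are part of the code and are otherwise unrestricted. -/
def Admissible {S : Type*} [Fintype S] [MeasurableSpace S] (P : Measure S)
    (L N m : ℕ) (R : Fin L → ℝ) : Prop :=
  (∀ l, 0 ≤ R l) ∧
    ∀ ε : ℝ, 0 < ε → ∀ᶠ n : ℕ in atTop,
      ∃ (M : Fin L → ℕ) (K : Type) (_ : MeasurableSpace K) (κ : Measure K)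
        (_ : IsProbabilityMeasure κ) (c : Code S K L m n M), c.Meets P κ N R ε

/-- The admissible rate region: the set of all admissible rate tuples. -/
def admissibleRegion {S : Type*} [Fintype S] [MeasurableSpace S] (P : Measure S)
    (L N m : ℕ) : Set (Fin L → ℝ) :=
  {R | Admissible P L N m R}

/-- `R(L, k, H)`: the nonnegative rate tuples whose sum over every set of `k` encoders is at
least `H`. -/
def rateRegion (L k : ℕ) (H : ℝ) : Set (Fin L → ℝ) :=
  {R | (∀ l, 0 ≤ R l) ∧ ∀ D : Finset (Fin L), D.card = k → H ≤ ∑ l ∈ D, R l}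

end SSDC

end

/-! Converse: for `|D| = m - N` pick a set `A` of `N` encoders outside `D`. The outputs of `A ∪ D`
decode, while `X_A` is independent of the source. For each fixed value of `X_D` the decoder is a
guess based on `X_A` alone, which hits a typical sequence with probability at most about `exp
(-nH)`. A union bound over the values of `X_D` forces `∏ l ∈ D, M l` to be roughly `exp (nH)` or
more (`one_sub_le_prod_mul_of_meets`).

Achievability: rates are rounded to whole numbers of symbols from a field of about `exp (n / t)`
elements, and an index of the typical sequence is shared by polynomial evaluation
(`exists_ramp_sharing`), with `w` message and `z` key symbols. Unequal rates are capped
(`exists_capped_rates`) so that `N` encoders hold at most `z` symbols and `m` encoders at least `w +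
z`, where `w` is the weight of a lightest `(m - N)`-set, large enough to index the typical
sequences.

Both halves use `eventually_exists_typical`, and `condEntropy_eq_entropy_iff` to turn secrecy into
independence. -/

noncomputable section

namespace SSDC

/-! ### Conditional entropy and independence -/

section Entropy

variable {Ω α β : Type*} [MeasurableSpace Ω] [Fintype α] [Fintype β]

/-- The law of total probability for a finitely valued random variable `Y`. -/
theorem sum_measureReal_inter_fiber (μ : Measure Ω) [IsFiniteMeasure μ] {Y : Ω → β}
    (hY : ∀ y, MeasurableSet {ω | Y ω = y}) {E : Set Ω} (hE : MeasurableSet E) :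
    ∑ y, μ.real {ω | ω ∈ E ∧ Y ω = y} = μ.real E := by
  rw [← measureReal_iUnion_fintype]
  · congr 1
    ext ω
    simp
  · intro a b hab
    rw [Function.onFun, Set.disjoint_left]
    rintro ω ⟨-, h⟩ ⟨-, h'⟩
    exact hab (h.symm.trans h')
  · exact fun y => hE.inter (hY y)

/-- Conditioning on `Y` leaves the entropy of `X` unchanged if and only if `X` and `Y` are
independent. -/
theorem condEntropy_eq_entropy_iff (μ : Measure Ω) [IsProbabilityMeasure μ] {X : Ω → α} {Y : Ω → β}
    (hX : ∀ x, MeasurableSet {ω | X ω = x}) (hY : ∀ y, MeasurableSet {ω | Y ω = y}) :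
    condEntropy μ X Y = entropy μ X ↔
      ∀ x y, μ.real {ω | X ω = x ∧ Y ω = y} = μ.real {ω | X ω = x} * μ.real {ω | Y ω = y} := by
  set p : β → ℝ := fun y => μ.real {ω | Y ω = y} with hp
  set c : α → β → ℝ := fun x y => μ.real {ω | X ω = x ∧ Y ω = y} / p y with hc
  have hp0 : ∀ y ∈ Finset.univ, 0 ≤ p y := fun y _ => measureReal_nonneg
  have hp1 : ∑ y, p y = 1 := by
    have := sum_measureReal_inter_fiber μ hY MeasurableSet.univ
    simpa using this
  have hjoint : ∀ x y, p y * c x y = μ.real {ω | X ω = x ∧ Y ω = y} := by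
    intro x y
    rcases eq_or_ne (p y) 0 with h | h
    · have hle : μ.real {ω | X ω = x ∧ Y ω = y} ≤ p y :=
        measureReal_mono (fun ω hω => hω.2)
      have h0 : 0 ≤ μ.real {ω | X ω = x ∧ Y ω = y} := measureReal_nonneg
      rw [h, zero_mul]
      linarith
    · exact mul_div_cancel₀ _ h
  have hmean : ∀ x, ∑ y, p y • c x y = μ.real {ω | X ω = x} := by
    intro x
    simp only [smul_eq_mul, hjoint]
    exact sum_measureReal_inter_fiber μ hY (hX x)
  have hc0 : ∀ x, ∀ y ∈ Finset.univ, c x y ∈ Set.Ici (0 : ℝ) := fun x y _ =>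
    div_nonneg measureReal_nonneg measureReal_nonneg
  have hcond : condEntropy μ X Y = ∑ x, ∑ y, p y • Real.negMulLog (c x y) := by
    rw [Finset.sum_comm]
    simp only [condEntropy, Finset.mul_sum, smul_eq_mul, hc, hp]
  have hle : ∀ x ∈ Finset.univ, ∑ y, p y • Real.negMulLog (c x y) ≤
      Real.negMulLog (μ.real {ω | X ω = x}) := fun x _ => by
    rw [← hmean]
    exact Real.concaveOn_negMulLog.le_map_sum hp0 hp1 (hc0 x)
  -- Jensen holds for each `x`, so equality of the sums is equality for each `x`; strict concavity
  -- then makes `c x y` constant over the `y` of positive probability.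
  rw [hcond, entropy, Finset.sum_eq_sum_iff_of_le hle]
  refine forall_congr' fun x => ?_
  simp only [Finset.mem_univ, true_imp_iff]
  have := Real.strictConcaveOn_negMulLog.map_sum_eq_iff' hp0 hp1 (hc0 x)
  rw [hmean, eq_comm] at this
  rw [this]
  refine forall_congr' fun y => ?_
  rw [← hjoint x y]
  simp only [Finset.mem_univ, true_imp_iff]
  change (p y ≠ 0 → _) ↔ _ = _ * p y
  constructor
  · intro h
    rcases eq_or_ne (p y) 0 with h0 | h0
    · simp [h0]
    · rw [h h0, mul_comm]
  · intro h h0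
    rw [mul_comm] at h
    exact mul_right_cancel₀ h0 h

end Entropy

/-! ### Typical sequences -/

section Typical

theorem measureReal_pi_singleton {S : Type*} [MeasurableSpace S] (P : Measure S) [IsProbabilityMeasure P] {n : ℕ} (s : Fin n → S) :
    (Measure.pi fun _ : Fin n => P).real {s} = ∏ i, P.real {s i} := by
  simp only [Measure.real, Measure.pi_singleton, ENNReal.toReal_prod]

variable {S : Type*} [Fintype S] [MeasurableSpace S] [MeasurableSingletonClass S]

theorem integral_neg_log_eq_sourceEntropy (P : Measure S) [IsProbabilityMeasure P] :
    ∫ s, -Real.log (P.real {s}) ∂P = sourceEntropy P := by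
  rw [integral_fintype .of_finite]
  simp [sourceEntropy, entropy, Real.negMulLog]

/-- The asymptotic equipartition property: for large `n`, the source sequence lies with probability
at least `1 - δ` in a set of sequences whose probabilities are all close to `exp (-n H)`. -/
theorem eventually_exists_typical (P : Measure S) [IsProbabilityMeasure P] {δ : ℝ} (hδ : 0 < δ) :
    ∀ᶠ n : ℕ in atTop, ∃ T : Finset (Fin n → S),
      (Measure.pi fun _ : Fin n => P).real {s | s ∉ T} ≤ δ ∧
      ∀ s ∈ T, Real.exp (-(n * (sourceEntropy P + δ))) ≤
          (Measure.pi fun _ : Fin n => P).real {s} ∧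
        (Measure.pi fun _ : Fin n => P).real {s} ≤ Real.exp (-(n * (sourceEntropy P - δ))) := by
  classical
  set f : S → ℝ := fun s => -Real.log (P.real {s}) with hf
  set V := ProbabilityTheory.variance f P with hV
  have hlim : Tendsto (fun n : ℕ => V / δ ^ 2 / (n : ℝ)) atTop (nhds 0) :=
    tendsto_const_div_atTop_nhds_zero_nat _
  filter_upwards [hlim.eventually_le_const hδ, eventually_gt_atTop 0] with n hn hn0
  have hn0' : (0 : ℝ) < n := by exact_mod_cast hn0
  set μ := Measure.pi fun _ : Fin n => P with hμ
  set X : (Fin n → S) → ℝ := ∑ i, fun ω => f (ω i) with hX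
  have hXa : ∀ s, X s = ∑ i, f (s i) := fun s => by simp [hX]
  have hmean : ∫ s, X s ∂μ = n * sourceEntropy P := by
    simp only [hXa]
    rw [integral_finsetSum _ fun i _ => Integrable.of_finite]
    have : ∀ i : Fin n, ∫ s, f (s i) ∂μ = sourceEntropy P := fun i => by
      rw [integral_comp_eval (μ := fun _ : Fin n => P) (f := f) (i := i) (by fun_prop),
        integral_neg_log_eq_sourceEntropy]
    simp [this]
  have hvar : ProbabilityTheory.variance X μ = n * V := by
    rw [hX, hμ, ProbabilityTheory.variance_sum_pi fun _ => MemLp.of_discrete]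
    simp [hV]
  -- Chebyshev: `n V / (n δ)² = V / δ² / n`, which is at most `δ` for large `n`.
  have hcheb : μ.real {s | n * δ ≤ |X s - n * sourceEntropy P|} ≤ δ := by
    have h := ProbabilityTheory.meas_ge_le_variance_div_sq (μ := μ) (X := X) MemLp.of_discrete
      (c := n * δ) (by positivity)
    rw [hmean, hvar] at h
    refine (ENNReal.toReal_le_of_le_ofReal ?_ (h.trans (ENNReal.ofReal_le_ofReal (le_trans ?_ hn))))
    · exact hδ.le
    · apply le_of_eq
      field_simp
  have hpos : ∀ᵐ s ∂μ, μ.real {s} ≠ 0 := by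
    rw [ae_iff_of_countable]
    intro s hs h
    exact hs ((measureReal_eq_zero_iff).1 h)
  -- Null sequences are excluded because `Real.log 0 = 0` would break `μ.real {s} = exp (-X s)`.
  refine ⟨Finset.univ.filter fun s => |X s - n * sourceEntropy P| < n * δ ∧ μ.real {s} ≠ 0, ?_, ?_⟩
  · refine le_trans (ENNReal.toReal_mono (measure_ne_top _ _) (measure_mono_ae ?_)) hcheb
    filter_upwards [hpos] with s hs hs'
    change s ∉ Finset.univ.filter _ at hs'
    change _ ≤ _
    by_contra h
    exact hs' (by simpa [hs] using not_le.1 h)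
  · intro s hs
    simp only [Finset.mem_filter, Finset.mem_univ, true_and] at hs
    have hlog : μ.real {s} = Real.exp (-X s) := by
      have hne := hs.2
      rw [hμ, measureReal_pi_singleton, Finset.prod_ne_zero_iff] at hne
      rw [hμ, measureReal_pi_singleton, hXa, ← Finset.sum_neg_distrib, Real.exp_sum]
      refine Finset.prod_congr rfl fun i hi => ?_
      rw [hf, neg_neg, Real.exp_log]
      exact lt_of_le_of_ne measureReal_nonneg (hne i hi).symm
    rw [hlog, Real.exp_le_exp, Real.exp_le_exp]
    have := abs_lt.1 hs.1
    constructor <;> nlinarith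

end Typical

/-! ### Ramp secret sharing with unequal shares -/

section SecretSharing

/-- Ramp secret sharing by polynomial evaluation: from `w` message symbols and `z` key symbols,
shares of `r l` symbols are formed such that shares with at least `w + z` symbols in total determine
the message, while shares with at most `z` symbols in total have a law that does not depend on it. -/
theorem exists_ramp_sharing {F ι : Type*} [Field F] [Fintype F] [Fintype ι] (w z : ℕ) (r : ι → ℕ)
    (hF : w + z + ∑ l, r l ≤ Fintype.card F) :
    ∃ enc : (Fin w → F) → (Fin z → F) → ∀ l, Fin (r l) → F,
      (∀ U : Finset ι, w + z ≤ ∑ l ∈ U, r l → ∀ W W' Z Z',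
        (∀ l ∈ U, enc W Z l = enc W' Z' l) → W = W') ∧
      ∀ A : Finset ι, ∑ l ∈ A, r l ≤ z → ∀ W W', ∃ Z₀, ∀ Z, ∀ l ∈ A,
        enc W' (Z + Z₀) l = enc W Z l := by
  classical
  -- Distinct nodes for message, key and share symbols: a polynomial of degree below `w + z` takes
  -- the message and key as values and is evaluated at the share nodes.
  obtain ⟨v⟩ : Nonempty (((Fin w ⊕ Fin z) ⊕ (Σ l, Fin (r l))) ↪ F) :=
    Function.Embedding.nonempty_of_card_le (by simpa using hF)
  set u : Fin w ⊕ Fin z → F := fun i => v (Sum.inl i) with hu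
  have hui : Set.InjOn u (Finset.univ : Finset (Fin w ⊕ Fin z)) :=
    fun a _ b _ h => Sum.inl_injective (v.injective h)
  have hcard : (Finset.univ : Finset (Fin w ⊕ Fin z)).card = w + z := by simp
  set p : (Fin w → F) → (Fin z → F) → Polynomial F := fun W Z =>
    Lagrange.interpolate Finset.univ u (Sum.elim W Z) with hp
  have hdeg : ∀ W Z, (p W Z).degree < ((w + z : ℕ) : WithBot ℕ) := fun W Z => by
    have := Lagrange.degree_interpolate_lt (Sum.elim W Z) hui
    rwa [hcard] at this
  have heval : ∀ W Z i, (p W Z).eval (u i) = Sum.elim W Z i := fun W Z i =>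
    Lagrange.eval_interpolate_at_node _ hui (Finset.mem_univ i)
  refine ⟨fun W Z l i => (p W Z).eval (v (Sum.inr ⟨l, i⟩)), ?_, ?_⟩
  · intro U hU W W' Z Z' h
    have hcardU : ((U.sigma fun _ => Finset.univ : Finset (Σ l, Fin (r l)))).card =
        ∑ l ∈ U, r l := by simp
    have hdeg' : ∀ W Z, (p W Z).degree <
        ((U.sigma fun _ => Finset.univ : Finset (Σ l, Fin (r l)))).card := fun W Z =>
      (hdeg W Z).trans_le (by rw [hcardU]; exact_mod_cast hU)
    have hpp : p W Z = p W' Z' := by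
      refine Polynomial.eq_of_degrees_lt_of_eval_index_eq
        (U.sigma fun _ => Finset.univ : Finset (Σ l, Fin (r l)))
        (v := fun i => v (Sum.inr i)) (fun a _ b _ h => Sum.inr_injective (v.injective h))
        (hdeg' W Z) (hdeg' W' Z') ?_
      rintro ⟨l, i⟩ hi
      exact congrFun (h l (Finset.mem_sigma.1 hi).1) i
    funext i
    have := heval W Z (Sum.inl i)
    rw [hpp, heval W' Z' (Sum.inl i)] at this
    exact this.symm
  · intro A hA W W'
    set s : Finset ((Fin w ⊕ Fin z) ⊕ (Σ l, Fin (r l))) :=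
      ((Finset.univ : Finset (Fin w)).map ⟨Sum.inl, Sum.inl_injective⟩).disjSum
        (A.sigma fun _ => Finset.univ) with hs
    have hscard : s.card ≤ w + z := by
      simpa [hs, Finset.card_disjSum] using hA
    have hvs : Set.InjOn v s := v.injective.injOn
    -- `g` moves the message from `W` to `W'` and vanishes at the nodes of `A`; its values at the
    -- key nodes are the shift `Z₀`.
    set ρ : (Fin w ⊕ Fin z) ⊕ (Σ l, Fin (r l)) → F :=
      Sum.elim (Sum.elim (W' - W) 0) 0 with hρ
    set g := Lagrange.interpolate s v ρ with hg
    have hgdeg : g.degree < ((w + z : ℕ) : WithBot ℕ) :=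
      (Lagrange.degree_interpolate_lt ρ hvs).trans_le (by exact_mod_cast hscard)
    refine ⟨fun i => g.eval (u (Sum.inr i)), fun Z l hl => ?_⟩
    have hpg : p W' (Z + fun i => g.eval (u (Sum.inr i))) = p W Z + g := by
      symm
      refine Lagrange.eq_interpolate_of_eval_eq _ hui ?_ ?_
      · rw [hcard]
        exact (Polynomial.degree_add_le _ _).trans_lt (max_lt (hdeg W Z) hgdeg)
      · rintro (i | i) -
        · have : g.eval (u (Sum.inl i)) = W' i - W i :=
            Lagrange.eval_interpolate_at_node ρ hvs (i := Sum.inl (Sum.inl i)) (by simp [hs])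
          rw [Polynomial.eval_add, heval, this]
          simp
        · rw [Polynomial.eval_add, heval]
          simp
    funext i
    have : g.eval (v (Sum.inr ⟨l, i⟩)) = 0 :=
      Lagrange.eval_interpolate_at_node ρ hvs (i := Sum.inr ⟨l, i⟩) (by simp [hs, hl])
    simp only [hpg, Polynomial.eval_add, this, add_zero]

/-- Capping every rate at the largest rate of a lightest set of `m - N` encoders makes the rates of
any `m` encoders exceed those of any `N` encoders by the total rate of that lightest set. -/
theorem exists_capped_rates {ι : Type*} [Fintype ι] {N m : ℕ} (hNm : N < m)
    (hm : m ≤ Fintype.card ι) (r : ι → ℕ) :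
    ∃ (r' : ι → ℕ) (D : Finset ι) (z : ℕ), (∀ l, r' l ≤ r l) ∧ D.card = m - N ∧
      (∀ A : Finset ι, A.card ≤ N → ∑ l ∈ A, r' l ≤ z) ∧
      ∀ U : Finset ι, m ≤ U.card → ∑ l ∈ D, r l + z ≤ ∑ l ∈ U, r' l := by
  classical
  obtain ⟨D, hD, hmin⟩ := Finset.exists_min_image (Finset.powersetCard (m - N) Finset.univ)
    (fun D : Finset ι => ∑ l ∈ D, r l)
    (Finset.powersetCard_nonempty.2 (by rw [Finset.card_univ]; omega))
  have hDc : D.card = m - N := (Finset.mem_powersetCard.1 hD).2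
  obtain ⟨j, hj, hjmax⟩ := Finset.exists_max_image D r (Finset.card_pos.1 (by omega))
  -- Otherwise exchanging `j` for `l` would give a lighter set than `D`.
  have hout : ∀ l, l ∉ D → r j ≤ r l := by
    intro l hl
    have hl' : l ∉ D.erase j := fun h => hl (Finset.mem_of_mem_erase h)
    have := hmin (insert l (D.erase j)) (Finset.mem_powersetCard.2 ⟨Finset.subset_univ _, by
      rw [Finset.card_insert_of_notMem hl', Finset.card_erase_of_mem hj]; omega⟩)
    rw [Finset.sum_insert hl', ← Finset.add_sum_erase D r hj] at this
    omega
  refine ⟨fun l => min (r l) (r j), D, N * r j, fun l => min_le_left _ _, hDc, ?_, ?_⟩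
  · intro A hA
    calc ∑ l ∈ A, min (r l) (r j) ≤ ∑ l ∈ A, r j := Finset.sum_le_sum fun l _ => min_le_right _ _
      _ = A.card * r j := by simp
      _ ≤ N * r j := Nat.mul_le_mul_right _ hA
  · intro U hU
    have h1 : ∑ l ∈ U, min (r l) (r j) = ∑ l ∈ U ∩ D, r l + (U \ D).card * r j := by
      rw [← Finset.sum_inter_add_sum_sdiff U D]
      congr 1
      · exact Finset.sum_congr rfl fun l hl => min_eq_left (hjmax l (Finset.mem_inter.1 hl).2)
      · rw [Finset.sum_congr rfl fun l hl => min_eq_right (hout l (Finset.mem_sdiff.1 hl).2)]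
        simp
    have h2 : ∑ l ∈ D, r l ≤ ∑ l ∈ U ∩ D, r l + (D \ U).card * r j := by
      rw [← Finset.sum_inter_add_sum_sdiff D U, Finset.inter_comm]
      gcongr
      rw [← smul_eq_mul]
      exact Finset.sum_le_card_nsmul _ _ _ fun l hl => hjmax l (Finset.mem_sdiff.1 hl).1
    -- Each encoder of `U \ D` carries `r j`: enough to replace those of `D \ U` and leave `N * r j`
    -- for the key.
    have h3 : (D \ U).card + N ≤ (U \ D).card := by
      have := Finset.card_sdiff_add_card_inter U D
      have := Finset.card_sdiff_add_card_inter D U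
      rw [Finset.inter_comm] at this
      omega
    rw [h1]
    nlinarith [Nat.mul_le_mul_right (r j) h3]

end SecretSharing

/-! ### The joint law of source and key -/

section Law

variable {S K : Type*} [MeasurableSpace S] [MeasurableSpace K]

instance isProbabilityMeasure_jointLaw (P : Measure S) [IsProbabilityMeasure P] (κ : Measure K)
    [IsProbabilityMeasure κ] (n : ℕ) : IsProbabilityMeasure (jointLaw P κ n) := by
  unfold jointLaw
  infer_instance

theorem jointLaw_real_source_mem (P : Measure S) [IsProbabilityMeasure P] (κ : Measure K)
    [IsProbabilityMeasure κ] {n : ℕ} (E : Set (Fin n → S)) :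
    (jointLaw P κ n).real {ω | ω.1 ∈ E} = (Measure.pi fun _ : Fin n => P).real E := by
  have : {ω : (Fin n → S) × K | ω.1 ∈ E} = E ×ˢ Set.univ := by
    ext ω
    simp
  rw [this, jointLaw, measureReal_prod_prod]
  simp

theorem measurableSet_output_fiber {L m n : ℕ} {M : Fin L → ℕ} (c : Code S K L m n M)
    (U : Finset (Fin L)) (y : ∀ l : U, Fin (M l)) : MeasurableSet {ω | c.output U ω = y} := by
  have h : Measurable (c.output U) := measurable_pi_lambda _ fun l => c.measurable_enc l
  exact h (measurableSet_singleton y)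

variable [Fintype S] [MeasurableSingletonClass S]

theorem measurableSet_source_mem {n : ℕ} (E : Set (Fin n → S)) :
    MeasurableSet {ω : (Fin n → S) × K | ω.1 ∈ E} :=
  measurable_fst (Set.toFinite E).measurableSet

/-- Perfect secrecy of the outputs of the encoders in `A` is independence from the source. -/
theorem secrecy_iff_independent {L m n : ℕ} {M : Fin L → ℕ} (c : Code S K L m n M)
    (P : Measure S) [IsProbabilityMeasure P] (κ : Measure K) [IsProbabilityMeasure κ]
    (A : Finset (Fin L)) :
    condEntropy (jointLaw P κ n) (fun ω => ω.1) (c.output A) =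
        entropy (jointLaw P κ n) (fun ω => ω.1) ↔
      ∀ s y, (jointLaw P κ n).real {ω | ω.1 = s ∧ c.output A ω = y} =
        (Measure.pi fun _ : Fin n => P).real {s} * (jointLaw P κ n).real {ω | c.output A ω = y} := by
  rw [condEntropy_eq_entropy_iff _ (fun x => measurableSet_source_mem {x})
    (measurableSet_output_fiber c A)]
  refine forall_congr' fun s => forall_congr' fun y => ?_
  rw [← jointLaw_real_source_mem P κ {s}]
  rfl

end Law

/-! ### Converse -/

section Converse

variable {S : Type*} [Fintype S] [MeasurableSpace S] [MeasurableSingletonClass S]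

/-- If the outputs of `A` are independent of the source, then guessing the source from the outputs
of `A ∪ D` amounts to picking one of at most `∏ l ∈ D, M l` sequences. -/
theorem one_sub_le_prod_mul_of_meets {K : Type*} [MeasurableSpace K] {L N m n : ℕ}
    {M : Fin L → ℕ} {c : Code S K L m n M} {P : Measure S} [IsProbabilityMeasure P] {κ : Measure K}
    [IsProbabilityMeasure κ] {R : Fin L → ℝ} {ε δ b : ℝ} (hc : c.Meets P κ N R ε)
    {A D : Finset (Fin L)} (hA : A.card ≤ N) (hAD : m ≤ (A ∪ D).card)
    {T : Finset (Fin n → S)} (hT : (Measure.pi fun _ : Fin n => P).real {s | s ∉ T} ≤ δ)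
    (hb0 : 0 ≤ b) (hb : ∀ s ∈ T, (Measure.pi fun _ : Fin n => P).real {s} ≤ b) :
    1 - ε - δ ≤ (∏ l ∈ D, (M l : ℝ)) * b := by
  classical
  set ν := jointLaw P κ n with hν
  set glue : (∀ l : A, Fin (M l)) → (∀ l : D, Fin (M l)) → ∀ l : ↥(A ∪ D), Fin (M l) :=
    fun y x l => if h : l.1 ∈ A then y ⟨l.1, h⟩ else
      x ⟨l.1, (Finset.mem_union.1 l.2).resolve_left h⟩ with hglue
  have hout : ∀ ω, c.output (A ∪ D) ω = glue (c.output A ω) (c.output D ω) := by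
    intro ω
    funext l
    simp only [hglue]
    split_ifs <;> rfl
  set d : (∀ l : A, Fin (M l)) → (∀ l : D, Fin (M l)) → Fin n → S :=
    fun y x => c.dec (A ∪ D) hAD (glue y x) with hd
  set E : Set ((Fin n → S) × K) :=
    {ω | ω.1 ∈ T ∧ d (c.output A ω) (c.output D ω) = ω.1} with hE
  have hind := (secrecy_iff_independent c P κ A).1 (hc.secrecy A hA)
  -- With `x` frozen, the guess `d y x` depends only on `y`, hence is independent of the source.
  have hterm : ∀ y x, ν.real {ω | ω.1 ∈ T ∧ d y x = ω.1 ∧ c.output A ω = y} ≤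
      b * ν.real {ω | c.output A ω = y} := by
    intro y x
    by_cases h : d y x ∈ T
    · calc ν.real {ω | ω.1 ∈ T ∧ d y x = ω.1 ∧ c.output A ω = y}
          ≤ ν.real {ω | ω.1 = d y x ∧ c.output A ω = y} :=
            measureReal_mono fun ω hω => ⟨hω.2.1.symm, hω.2.2⟩
        _ = _ := hind _ _
        _ ≤ _ := by gcongr; exact hb _ h
    · have : {ω : (Fin n → S) × K | ω.1 ∈ T ∧ d y x = ω.1 ∧ c.output A ω = y} = ∅ := by
        ext ω
        simp only [Set.mem_ofPred_eq, Set.mem_empty_iff_false, iff_false]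
        rintro ⟨h1, h2, -⟩
        exact h (h2 ▸ h1)
      rw [this, measureReal_empty]
      positivity
  have hcov : E ⊆ ⋃ i : (∀ l : A, Fin (M l)) × (∀ l : D, Fin (M l)),
      {ω | ω.1 ∈ T ∧ d i.1 i.2 = ω.1 ∧ c.output A ω = i.1} := fun ω hω =>
    Set.mem_iUnion.2 ⟨(c.output A ω, c.output D ω), hω.1, hω.2, rfl⟩
  have hsum1 : ∑ y, ν.real {ω | c.output A ω = y} = 1 := by
    simpa using sum_measureReal_inter_fiber ν (measurableSet_output_fiber c A) MeasurableSet.univ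
  have hEle : ν.real E ≤ (∏ l ∈ D, (M l : ℝ)) * b := by
    calc ν.real E ≤ _ := measureReal_mono hcov
      _ ≤ _ := measureReal_iUnion_fintype_le _
      _ ≤ ∑ i : (∀ l : A, Fin (M l)) × (∀ l : D, Fin (M l)),
            b * ν.real {ω | c.output A ω = i.1} := Finset.sum_le_sum fun i _ => hterm i.1 i.2
      _ = _ := by
        rw [Fintype.sum_prod_type]
        simp only [Finset.sum_const, Finset.card_univ, nsmul_eq_mul]
        rw [← Finset.mul_sum, ← Finset.mul_sum, hsum1, Fintype.card_pi]
        simp only [Fintype.card_fin, mul_one]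
        rw [← Finset.prod_coe_sort D fun l => (M l : ℝ)]
        push_cast
        rfl
  have hcompl : (Set.univ : Set ((Fin n → S) × K)) ⊆
      E ∪ ({ω | c.dec (A ∪ D) hAD (c.output (A ∪ D) ω) ≠ ω.1} ∪ {ω | ω.1 ∈ {s | s ∉ T}}) := by
    intro ω _
    by_cases h1 : ω.1 ∈ T
    · by_cases h2 : d (c.output A ω) (c.output D ω) = ω.1
      · exact Or.inl ⟨h1, h2⟩
      · refine Or.inr (Or.inl ?_)
        change _ ≠ _
        rw [hout]
        exact h2
    · exact Or.inr (Or.inr h1)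
  have h1 : ν.real Set.univ ≤ _ := measureReal_mono (μ := ν) hcompl
  rw [probReal_univ] at h1
  have h2 := measureReal_union_le (μ := ν) E
    ({ω | c.dec (A ∪ D) hAD (c.output (A ∪ D) ω) ≠ ω.1} ∪ {ω | ω.1 ∈ {s | s ∉ T}})
  have h3 := measureReal_union_le (μ := ν)
    {ω | c.dec (A ∪ D) hAD (c.output (A ∪ D) ω) ≠ ω.1} {ω | ω.1 ∈ {s | s ∉ T}}
  have h4 := hc.reconstruction (A ∪ D) hAD
  have h5 : ν.real {ω | ω.1 ∈ {s | s ∉ T}} ≤ δ := by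
    rw [hν, jointLaw_real_source_mem]
    exact hT
  linarith

theorem le_sum_of_admissible {P : Measure S} [IsProbabilityMeasure P] {L N m : ℕ} (hNm : N < m)
    (hmL : m ≤ L) {R : Fin L → ℝ} (hR : Admissible P L N m R) {D : Finset (Fin L)}
    (hD : D.card = m - N) : sourceEntropy P ≤ ∑ l ∈ D, R l := by
  obtain ⟨A, hAD, hA⟩ : ∃ A ⊆ Dᶜ, A.card = N :=
    Finset.exists_subset_card_eq (by rw [Finset.card_compl, Fintype.card_fin]; omega)
  have hAD' : m ≤ (A ∪ D).card := by
    rw [Finset.card_union_of_disjoint (Finset.disjoint_left.2 fun l hl =>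
      Finset.mem_compl.1 (hAD hl))]
    omega
  by_contra! hlt
  set γ := sourceEntropy P - ∑ l ∈ D, R l with hγ
  have hγ0 : 0 < γ := by linarith
  -- The exponent loses `|D| ε` to the rates and `ε` to typicality, leaving `γ / 2`; the bound `1 /
  -- 8` keeps `1 - 2 ε` above `1 / 2`.
  set ε : ℝ := min (1 / 8) (γ / (2 * (D.card + 1))) with hε
  have hε0 : 0 < ε := by positivity
  have hε1 : ε ≤ 1 / 8 := min_le_left _ _
  have hε2 : (D.card + 1) * ε ≤ γ / 2 := by
    have : ε ≤ γ / (2 * (D.card + 1)) := min_le_right _ _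
    rw [le_div_iff₀ (by positivity)] at this
    linarith
  have hlim : Tendsto (fun n : ℕ => Real.exp (-(n * (γ / 2)))) atTop (nhds 0) :=
    Real.tendsto_exp_neg_atTop_nhds_zero.comp
      (tendsto_natCast_atTop_atTop.atTop_mul_const (by positivity))
  obtain ⟨n, ⟨M, K, mK, κ, hκ, c, hc⟩, ⟨T, hT1, hT2⟩, hn, hn0⟩ :=
    ((hR.2 ε hε0).and ((eventually_exists_typical P hε0).and
      ((hlim.eventually_lt_const (show (0 : ℝ) < 1 / 2 by norm_num)).and
        (eventually_gt_atTop 0)))).exists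
  have hn0' : (0 : ℝ) < n := by exact_mod_cast hn0
  have hmain := one_sub_le_prod_mul_of_meets hc hA.le hAD' hT1 (Real.exp_nonneg _)
    fun s hs => (hT2 s hs).2
  have hM : ∀ l ∈ D, (M l : ℝ) ≤ Real.exp (n * (R l + ε)) := by
    intro l _
    rcases (M l).eq_zero_or_pos with h | h
    · rw [h]
      simpa using Real.exp_nonneg _
    · rw [← Real.log_le_iff_le_exp (by exact_mod_cast h)]
      have := hc.rate l
      rw [div_le_iff₀ hn0'] at this
      linarith
  have hprod : ∏ l ∈ D, (M l : ℝ) ≤ Real.exp (n * (∑ l ∈ D, R l + D.card * ε)) := by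
    refine (Finset.prod_le_prod (fun _ _ => Nat.cast_nonneg _) hM).trans_eq ?_
    rw [← Real.exp_sum, ← Finset.mul_sum, Finset.sum_add_distrib]
    simp
  have : (∏ l ∈ D, (M l : ℝ)) * Real.exp (-(n * (sourceEntropy P - ε))) ≤
      Real.exp (-(n * (γ / 2))) := by
    refine (mul_le_mul_of_nonneg_right hprod (Real.exp_nonneg _)).trans ?_
    rw [← Real.exp_add, Real.exp_le_exp]
    have := mul_le_mul_of_nonneg_left hε2 hn0'.le
    rw [hγ] at this ⊢
    linarith
  linarith

end Converse

/-! ### Achievability -/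

section Achievability

variable {S : Type*} [Fintype S] [MeasurableSpace S] [MeasurableSingletonClass S]

/-- A secret sharing scheme with a uniformly distributed finite key, applied to a message that
identifies the sequences in `T`, gives a perfectly secret code that errs only outside `T`. -/
theorem exists_code_of_sharing {P : Measure S} [IsProbabilityMeasure P] {L N m n : ℕ}
    {M : Fin L → ℕ} {W K : Type*} [Fintype K] [Nonempty K] [MeasurableSpace K]
    [MeasurableSingletonClass K] (sh : W → K → ∀ l, Fin (M l))
    (hrec : ∀ U : Finset (Fin L), m ≤ U.card → ∀ a a' k k',
      (∀ l ∈ U, sh a k l = sh a' k' l) → a = a')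
    (hsec : ∀ A : Finset (Fin L), A.card ≤ N → ∀ a a', ∃ e : K ≃ K, ∀ k, ∀ l ∈ A,
      sh a' (e k) l = sh a k l)
    {T : Finset (Fin n → S)} {g : (Fin n → S) → W} (hg : Set.InjOn g T) :
    ∃ (κ : Measure K) (_ : IsProbabilityMeasure κ) (c : Code S K L m n M),
      (∀ (U : Finset (Fin L)) (hU : m ≤ U.card),
        (jointLaw P κ n).real {ω | c.dec U hU (c.output U ω) ≠ ω.1} ≤
          (Measure.pi fun _ : Fin n => P).real {s | s ∉ T}) ∧
      ∀ A : Finset (Fin L), A.card ≤ N →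
        condEntropy (jointLaw P κ n) (fun ω => ω.1) (c.output A) =
          entropy (jointLaw P κ n) (fun ω => ω.1) := by
  classical
  have : Nonempty S := nonempty_of_isProbabilityMeasure P
  set κ : Measure K := (PMF.uniformOfFintype K).toMeasure with hκ
  set c : Code S K L m n M :=
    { enc := fun l ω => sh (g ω.1) ω.2 l
      measurable_enc := fun l => Measurable.of_discrete
      -- Any sequence of `T` consistent with `y` under some key will do: `hrec` and injectivity of
      -- `g` on `T` make it the true one if that lies in `T`.
      dec := fun U _ y =>
        if h : ∃ s ∈ T, ∃ k, ∀ l : U, sh (g s) k l = y l then h.choose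
        else Classical.arbitrary _ } with hc
  refine ⟨κ, inferInstance, c, fun U hU => ?_, fun A hA => ?_⟩
  · rw [← jointLaw_real_source_mem P κ]
    refine measureReal_mono fun ω hω hωT => hω ?_
    have h : ∃ s ∈ T, ∃ k, ∀ l : U, sh (g s) k l = c.output U ω l := ⟨ω.1, hωT, ω.2, fun _ => rfl⟩
    have hdec : c.dec U hU (c.output U ω) = h.choose := dif_pos h
    rw [hdec]
    obtain ⟨hT, k, hk⟩ := h.choose_spec
    exact hg hT hωT (hrec U hU _ _ k ω.2 fun l hl => hk ⟨l, hl⟩)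
  · rw [secrecy_iff_independent]
    set G : W → (∀ l : A, Fin (M l)) → Set K := fun a y => {k | (fun l : A => sh a k l) = y} with hG
    -- `e` matches the keys yielding `y` from `a` with those yielding it from `a'`, and the key is
    -- uniform.
    have hGeq : ∀ a a' y, κ.real (G a y) = κ.real (G a' y) := by
      intro a a' y
      obtain ⟨e, he⟩ := hsec A hA a a'
      have hcard : Fintype.card (G a y) = Fintype.card (G a' y) := by
        refine Fintype.card_congr (e.subtypeEquiv fun k => ?_)
        have : (fun l : A => sh a' (e k) l) = fun l : A => sh a k l :=
          funext fun l => he k l l.2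
        change (fun l : A => sh a k l) = y ↔ (fun l : A => sh a' (e k) l) = y
        rw [this]
      rw [Measure.real, Measure.real, hκ,
        PMF.toMeasure_uniformOfFintype_apply _ (Set.toFinite _).measurableSet,
        PMF.toMeasure_uniformOfFintype_apply _ (Set.toFinite _).measurableSet, hcard]
    have hjoint : ∀ s y, (jointLaw P κ n).real {ω | ω.1 = s ∧ c.output A ω = y} =
        (Measure.pi fun _ : Fin n => P).real {s} * κ.real (G (g s) y) := by
      intro s y
      have : {ω : (Fin n → S) × K | ω.1 = s ∧ c.output A ω = y} = {s} ×ˢ G (g s) y := by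
        ext ω
        simp only [Set.mem_ofPred_eq, Set.mem_prod, Set.mem_singleton_iff]
        refine and_congr_right fun h => ?_
        rw [← h]
        rfl
      rw [this, jointLaw, measureReal_prod_prod]
    intro s y
    have hmarg : (jointLaw P κ n).real {ω | c.output A ω = y} = κ.real (G (g s) y) := by
      have h := sum_measureReal_inter_fiber (jointLaw P κ n) (Y := fun ω => ω.1)
        (fun x => measurableSet_source_mem {x}) (measurableSet_output_fiber c A y)
      have h1 : ∑ x, (Measure.pi fun _ : Fin n => P).real {x} = 1 := by
        simp
      rw [← h]
      calc _ = ∑ x, (Measure.pi fun _ : Fin n => P).real {x} * κ.real (G (g s) y) := by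
            refine Finset.sum_congr rfl fun x _ => ?_
            rw [hGeq (g s) (g x), ← hjoint]
            congr 1
            ext ω
            exact and_comm
        _ = _ := by rw [← Finset.sum_mul, h1, one_mul]
    rw [hjoint, hmarg]

theorem card_mul_le_one {α : Type*} [MeasurableSpace α] [MeasurableSingletonClass α]
    (μ : Measure α) [IsProbabilityMeasure μ] {T : Finset α} {b : ℝ}
    (hb : ∀ s ∈ T, b ≤ μ.real {s}) : T.card * b ≤ 1 := by
  calc T.card * b ≤ ∑ s ∈ T, μ.real {s} := by
        rw [← nsmul_eq_mul]
        exact Finset.card_nsmul_le_sum _ _ _ hb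
    _ = μ.real T := sum_measureReal_singleton _
    _ ≤ 1 := measureReal_le_one

/-- Bertrand's postulate. Rounding up and doubling each cost at most a factor 2, hence an additive
`log 4`, negligible per source letter. -/
theorem exists_prime_mem_exp_Icc {x : ℝ} (hx : 0 ≤ x) :
    ∃ q : ℕ, q.Prime ∧ Real.exp x ≤ q ∧ Real.log q ≤ x + Real.log 4 := by
  have h1 : 1 ≤ Real.exp x := Real.one_le_exp hx
  have h2 : Real.exp x ≤ ⌈Real.exp x⌉₊ := Nat.le_ceil _
  have h3 : (⌈Real.exp x⌉₊ : ℝ) < Real.exp x + 1 := Nat.ceil_lt_add_one (Real.exp_nonneg x)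
  obtain ⟨q, hq, hlt, hle⟩ := Nat.exists_prime_lt_and_le_two_mul ⌈Real.exp x⌉₊ (by
    rw [← Nat.pos_iff_ne_zero, Nat.ceil_pos]
    exact Real.exp_pos x)
  have hlt' : (⌈Real.exp x⌉₊ : ℝ) < q := by exact_mod_cast hlt
  have hle' : (q : ℝ) ≤ 2 * ⌈Real.exp x⌉₊ := by exact_mod_cast hle
  refine ⟨q, hq, by linarith, ?_⟩
  rw [← Real.log_exp x, ← Real.log_mul (Real.exp_ne_zero _) (by norm_num)]
  exact Real.log_le_log (by linarith) (by linarith)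

theorem admissible_of_mem_rateRegion {P : Measure S} [IsProbabilityMeasure P] {L N m : ℕ}
    (hNm : N < m) (hmL : m ≤ L) {R : Fin L → ℝ}
    (hR : R ∈ rateRegion L (m - N) (sourceEntropy P)) : Admissible P L N m R := by
  classical
  refine ⟨hR.1, fun ε hε => ?_⟩
  -- One field symbol amounts to rate about `1 / t`, so rounding up to whole symbols costs at most
  -- `ε / 4`. The symbol counts do not depend on `n`; only the field grows.
  obtain ⟨t, ht⟩ := exists_gt (4 / ε)
  have ht0 : 0 < t := lt_trans (by positivity) ht
  have htε : 1 ≤ t * (ε / 4) := by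
    rw [div_lt_iff₀ hε] at ht
    linarith
  set r₀ : Fin L → ℕ := fun l => ⌈t * (R l + ε / 4)⌉₊ with hr₀
  obtain ⟨r, D, z, hrr₀, hD, hA, hU⟩ := exists_capped_rates hNm (by simpa using hmL) r₀
  set w := ∑ l ∈ D, r₀ l with hw
  have hwH : t * (sourceEntropy P + ε / 4) ≤ w := by
    have h1 : ∑ l ∈ D, t * (R l + ε / 4) ≤ w := by
      rw [hw]
      push_cast
      exact Finset.sum_le_sum fun l _ => Nat.le_ceil _
    refine le_trans ?_ h1
    rw [← Finset.mul_sum, Finset.sum_add_distrib]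
    have h2 := hR.2 D hD
    have h3 : ε / 4 ≤ ∑ _l ∈ D, ε / 4 := by
      rw [Finset.sum_const, nsmul_eq_mul]
      have : (1 : ℝ) ≤ D.card := by
        rw [hD]
        exact_mod_cast (by omega : 1 ≤ m - N)
      nlinarith
    gcongr
  have hrlim : ∀ᶠ n : ℕ in atTop, ∀ l, r l * Real.log 4 / (n : ℝ) ≤ ε / 2 :=
    eventually_all.2 fun l => (tendsto_const_div_atTop_nhds_zero_nat _).eventually_le_const
      (by positivity)
  have hexp : Tendsto (fun n : ℕ => Real.exp (n / t)) atTop atTop :=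
    Real.tendsto_exp_atTop.comp (tendsto_natCast_atTop_atTop.atTop_div_const ht0)
  filter_upwards [hrlim, hexp.eventually_ge_atTop ((w + z + ∑ l, r l : ℕ) : ℝ),
    eventually_exists_typical P (show (0 : ℝ) < ε / 4 by positivity),
    eventually_gt_atTop 0] with n hn1 hn2 ⟨T, hT1, hT2⟩ hn0
  have hn0' : (0 : ℝ) < n := by exact_mod_cast hn0
  obtain ⟨q, hq, hq1, hq2⟩ := exists_prime_mem_exp_Icc (show (0 : ℝ) ≤ n / t by positivity)
  have : Fact q.Prime := ⟨hq⟩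
  obtain ⟨enc, henc1, henc2⟩ := exists_ramp_sharing (F := ZMod q) w z r (by
    rw [ZMod.card]
    exact_mod_cast hn2.trans hq1)
  -- `|T| ≤ exp (n (H + ε / 4)) ≤ exp (w n / t) ≤ q ^ w`, so `w` symbols index `T`.
  have hTcard : T.card ≤ q ^ w := by
    have h1 := card_mul_le_one _ fun s hs => (hT2 s hs).1
    rw [Real.exp_neg, ← div_eq_mul_inv, div_le_one (Real.exp_pos _)] at h1
    have h2 : Real.exp (n * (sourceEntropy P + ε / 4)) ≤ Real.exp (w * (n / t)) := by
      rw [Real.exp_le_exp, mul_div_assoc', le_div_iff₀ ht0]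
      nlinarith
    have h3 : Real.exp (w * (n / t)) ≤ (q : ℝ) ^ w := by
      rw [Real.exp_nat_mul]
      gcongr
    exact_mod_cast (h1.trans h2).trans h3
  obtain ⟨g₀⟩ : Nonempty (T ↪ (Fin w → ZMod q)) :=
    Function.Embedding.nonempty_of_card_le (by simpa [ZMod.card] using hTcard)
  set g : (Fin n → S) → Fin w → ZMod q := fun s => if h : s ∈ T then g₀ ⟨s, h⟩ else 0 with hg
  have hgT : Set.InjOn g T := by
    intro s hs s' hs' h
    simp only [hg, dif_pos (Finset.mem_coe.1 hs), dif_pos (Finset.mem_coe.1 hs')] at h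
    exact congrArg Subtype.val (g₀.injective h)
  have e : ∀ l, (Fin (r l) → ZMod q) ≃ Fin (q ^ r l) := fun l =>
    Fintype.equivFinOfCardEq (by simp [ZMod.card])
  let mK : MeasurableSpace (Fin z → ZMod q) := ⊤
  have : MeasurableSingletonClass (Fin z → ZMod q) := ⟨fun _ => trivial⟩
  obtain ⟨κ, hκ, c, hc1, hc2⟩ := exists_code_of_sharing (P := P) (N := N) (m := m)
    (fun W Z l => e l (enc W Z l))
    (fun U hUm W W' Z Z' h => henc1 U (hU U hUm) W W' Z Z' fun l hl => (e l).injective (h l hl))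
    (fun A hAN W W' => by
      obtain ⟨Z₀, hZ₀⟩ := henc2 A (hA A hAN) W W'
      exact ⟨Equiv.addRight Z₀, fun Z l hl => congrArg (e l) (hZ₀ Z l hl)⟩) hgT
  refine ⟨_, _, mK, κ, hκ, c, fun l => ?_, fun U hUm => ?_, hc2⟩
  -- Rounding and slack use `ε / 2` of the rate tolerance, the `log 4` overhead the other half.
  · push_cast
    rw [Real.log_pow]
    have h1 : (r l : ℝ) * Real.log q ≤ r l * (n / t) + r l * Real.log 4 := by
      rw [← mul_add]
      gcongr
    have h2 : (r l : ℝ) ≤ t * (R l + ε / 2) := by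
      have h3 : (r l : ℝ) ≤ r₀ l := by exact_mod_cast hrr₀ l
      have h4 : (r₀ l : ℝ) < t * (R l + ε / 4) + 1 :=
        Nat.ceil_lt_add_one (mul_nonneg ht0.le (by linarith [hR.1 l]))
      linarith
    have h5 : (r l : ℝ) * (n / t) ≤ n * (R l + ε / 2) := by
      rw [mul_div_assoc', div_le_iff₀ ht0]
      nlinarith
    have h6 := hn1 l
    rw [div_le_iff₀ hn0'] at h6 ⊢
    linarith
  · linarith [hc1 U hUm]

end Achievability

end SSDC

end

theorem theorem1 {S : Type*} [Fintype S] [MeasurableSpace S] [MeasurableSingletonClass S]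
    (P : Measure S) [IsProbabilityMeasure P] (L N m : ℕ) (hNm : N < m) (hmL : m ≤ L) :
    SSDC.admissibleRegion P L N m = SSDC.rateRegion L (m - N) (SSDC.sourceEntropy P) := by
  exact Set.Subset.antisymm
    (fun _ hR => ⟨hR.1, fun _ hD => SSDC.le_sum_of_admissible hNm hmL hR hD⟩)
    fun _ hR => SSDC.admissible_of_mem_rateRegion hNm hmL hR
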